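/- Let $k \ge 1$, let $d_0, \dots, d_k$ and $n$ be natural numbers, and let $X \in \mathbb{R}^{d_0 \times n}$ and $Y \in \mathbb{R}^{d_k \times n}$ be arbitrary. For matrices $M_i \in \mathbb{R}^{d_i \times d_{i-1}}$ ($1 \le i \le k$) let $$L(M_1, \dots, M_k) = \| M_k M_{k-1} \cdots M_1 X - Y \|_F^2,$$ where $\|\cdot\|_F$ is the Frobenius norm. Then $L$ has no spurious local minima, that is, every local minimum of $L$ on $\prod_{i=1}^k \mathbb{R}^{d_i \times d_{i-1}}$ is a global minimum. Here $(M_1, \dots, M_k)$ is a local minimum of $L$ if $L(M_1,\dots,M_k)$ is the minimum of $L$ over some open Euclidean (Frobenius) ball centred at $(M_1, \dots, M_k)$. -/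

import Mathlib

namespace DeepLinear

/-- The parameters `M_1, …, M_k` of a deep linear network with layer widths `d 0, …, d k`.
The matrix at index `i : Fin k` is the layer `M_{i+1} ∈ ℝ^{d_{i+1} × d_i}`.
The values of `d` beyond `k` play no role. The space carries the product topology. -/
abbrev Params (d : ℕ → ℕ) (k : ℕ) : Type :=
  ∀ i : Fin k, Matrix (Fin (d (i + 1))) (Fin (d i)) ℝ

/-- The product `M_k ⋯ M_1 ∈ ℝ^{d_k × d_0}`. -/
noncomputable def layerProd (d : ℕ → ℕ) :
    (k : ℕ) → Params d k → Matrix (Fin (d k)) (Fin (d 0)) ℝ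
  | 0, _ => 1
  | k + 1, M =>
      let W : Matrix (Fin (d (k + 1))) (Fin (d k)) ℝ := M (Fin.last k)
      W * layerProd d k (fun i => M i.castSucc)

section

attribute [local instance] Matrix.frobeniusNormedAddCommGroup

/-- The least squares loss `‖M_k ⋯ M_1 X - Y‖²`, where `‖·‖` is the Frobenius norm. -/
noncomputable def loss (d : ℕ → ℕ) (k n : ℕ) (X : Matrix (Fin (d 0)) (Fin n) ℝ)
    (Y : Matrix (Fin (d k)) (Fin n) ℝ) (M : Params d k) : ℝ :=
  ‖layerProd d k M * X - Y‖ ^ 2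

end

/-- A spurious local minimum of `L`: a local minimum that is not a global minimum. -/
def IsSpuriousLocalMin {E : Type*} [TopologicalSpace E] (L : E → ℝ) (M : E) : Prop :=
  IsLocalMin L M ∧ ¬ ∀ N : E, L M ≤ L N

end DeepLinear

namespace DeepLinear

open Matrix Filter Topology

/-! Factor `X = S * T` with orthonormal rows in `T`. By Pythagoras the loss is a constant plus `‖W *
S - Y * Tᵀ‖²`, where `W` is the layer product. Absorbing `S` into the first layer leaves the problem
of approximating a matrix `Z` by a product of layers.

A dichotomy on ranks follows (`exists_full_rank_or_degenerate`). In the degenerate case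
(`residual_eq_zero`), rank-one perturbations of the layers around some layer `m` leave the product
unchanged. All these nearby points are again local minima, so the gradient at `m` vanishes at each
of them, which forces the residual to be zero.

Otherwise the product splits at some width as `B * A` with `B` injective and `A` surjective. At an
end of the network one layer already moves the product in every direction, so the residual vanishes.
At an inner width the first and last layers move `A` and `B` independently. The second order
condition then bounds the operator norm of the residual by the singular values of `B * A` on the row
space of `A`, and an Eckart–Young argument gives global optimality (`best_approx_of_second_order`).
-/

/-- The Frobenius inner product. -/
noncomputable def fro {m n : Type*} [Fintype m] [Fintype n] (A B : Matrix m n ℝ) : ℝ :=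
  (Aᵀ * B).trace

/-! ### Frobenius inner product -/

section fro

variable {l m n : Type*} [Fintype l] [Fintype m] [Fintype n]

lemma fro_eq_sum (A B : Matrix m n ℝ) : fro A B = ∑ j, A.col j ⬝ᵥ B.col j := by
  simp [fro, trace, mul_apply, dotProduct]

lemma fro_comm (A B : Matrix m n ℝ) : fro A B = fro B A := by
  simp only [fro_eq_sum, dotProduct_comm]

lemma fro_add_left (A B C : Matrix m n ℝ) : fro (A + B) C = fro A C + fro B C := by
  simp [fro, Matrix.add_mul]

lemma fro_add_right (A B C : Matrix m n ℝ) : fro A (B + C) = fro A B + fro A C := by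
  simp [fro, Matrix.mul_add]

lemma fro_smul_left (t : ℝ) (A B : Matrix m n ℝ) : fro (t • A) B = t * fro A B := by
  simp [fro]

lemma fro_smul_right (t : ℝ) (A B : Matrix m n ℝ) : fro A (t • B) = t * fro A B := by
  simp [fro]

lemma fro_neg_left (A B : Matrix m n ℝ) : fro (-A) B = - fro A B := by
  simp [fro]

lemma fro_neg_right (A B : Matrix m n ℝ) : fro A (-B) = - fro A B := by
  simp [fro]

lemma fro_sub_left (A B C : Matrix m n ℝ) : fro (A - B) C = fro A C - fro B C := by
  simp [fro, Matrix.sub_mul]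

lemma fro_sub_right (A B C : Matrix m n ℝ) : fro A (B - C) = fro A B - fro A C := by
  simp [fro, Matrix.mul_sub]

lemma fro_self_nonneg (A : Matrix m n ℝ) : 0 ≤ fro A A := by
  rw [fro_eq_sum]
  exact Finset.sum_nonneg fun j _ => Finset.sum_nonneg fun i _ => mul_self_nonneg _

lemma fro_self_eq_zero {A : Matrix m n ℝ} (h : fro A A = 0) : A = 0 := by
  have := trace_conjTranspose_mul_self_eq_zero_iff (A := A)
  rw [conjTranspose_eq_transpose_of_trivial] at this
  exact this.1 h

lemma fro_mul_right_left (A : Matrix m n ℝ) (B : Matrix m l ℝ) (C : Matrix l n ℝ) :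
    fro A (B * C) = fro (Bᵀ * A) C := by
  simp [fro, Matrix.mul_assoc]

lemma fro_mul_right_right (A : Matrix m n ℝ) (B : Matrix m l ℝ) (C : Matrix l n ℝ) :
    fro A (B * C) = fro (A * Cᵀ) B := by
  rw [fro, fro, transpose_mul, transpose_transpose, ← Matrix.mul_assoc, trace_mul_comm,
    Matrix.mul_assoc]

section

attribute [local instance] Matrix.frobeniusNormedAddCommGroup

lemma frobenius_norm_sq_eq_fro (A : Matrix m n ℝ) : ‖A‖ ^ 2 = fro A A := by
  rw [frobenius_norm_def, ← Real.sqrt_eq_rpow, Real.sq_sqrt, fro_eq_sum, Finset.sum_comm]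
  · simp [dotProduct, pow_two]
  · positivity

end

lemma fro_vecMulVec (G : Matrix m n ℝ) (a : m → ℝ) (b : n → ℝ) :
    fro G (vecMulVec a b) = a ⬝ᵥ G *ᵥ b := by
  simp only [fro_eq_sum, dotProduct, mulVec, col_apply, vecMulVec_apply, Finset.mul_sum]
  rw [Finset.sum_comm]
  exact Finset.sum_congr rfl fun i _ => Finset.sum_congr rfl fun j _ => by ring

lemma fro_vecMulVec_vecMulVec (a c : m → ℝ) (b d : n → ℝ) :
    fro (vecMulVec a b) (vecMulVec c d) = (a ⬝ᵥ c) * (b ⬝ᵥ d) := by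
  have h : vecMulVec a b *ᵥ d = (b ⬝ᵥ d) • a := by
    ext i
    simp only [mulVec, dotProduct, vecMulVec_apply, Pi.smul_apply, smul_eq_mul, Finset.sum_mul]
    exact Finset.sum_congr rfl fun j _ => by ring
  rw [fro_vecMulVec, h, dotProduct_smul, smul_eq_mul, dotProduct_comm c, mul_comm]

lemma fro_mul_self (A : Matrix l m ℝ) (C : Matrix m n ℝ) :
    fro (A * C) (A * C) = ∑ j, (A *ᵥ C.col j) ⬝ᵥ (A *ᵥ C.col j) := by
  rw [fro_eq_sum]
  rfl

/-- Pythagoras: `Tᵀ * T` is the orthogonal projection onto the row space of `T`. -/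
lemma fro_sub_mul_proj [DecidableEq l] (D : Matrix m n ℝ) {T : Matrix l n ℝ}
    (hT : T * Tᵀ = 1) :
    fro (D - D * (Tᵀ * T)) (D - D * (Tᵀ * T)) = fro D D - fro (D * Tᵀ) (D * Tᵀ) := by
  have h1 : fro D (D * (Tᵀ * T)) = fro (D * Tᵀ) (D * Tᵀ) := by
    rw [← Matrix.mul_assoc, fro_mul_right_right]
  have h2 : fro (D * (Tᵀ * T)) (D * (Tᵀ * T)) = fro (D * Tᵀ) (D * Tᵀ) := by
    rw [← Matrix.mul_assoc, fro_mul_right_right, Matrix.mul_assoc (D * Tᵀ), hT, Matrix.mul_one]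
  rw [fro_sub_left, fro_sub_right, fro_sub_right, fro_comm (D * (Tᵀ * T)) D, h1, h2]
  ring

end fro

/-! ### Optimality conditions along polynomial curves -/

lemma coeff_of_eventually_nonneg {a b c e : ℝ}
    (h : ∀ᶠ t in 𝓝 (0 : ℝ), 0 ≤ a * t + b * t ^ 2 + c * t ^ 3 + e * t ^ 4) : a = 0 ∧ 0 ≤ b := by
  have ha : a = 0 := by
    have hd : HasDerivAt (fun t : ℝ => a * t + b * t ^ 2 + c * t ^ 3 + e * t ^ 4) a 0 := by
      have := ((((hasDerivAt_id (0 : ℝ)).const_mul a).add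
        (((hasDerivAt_id (0 : ℝ)).pow 2).const_mul b)).add
        (((hasDerivAt_id (0 : ℝ)).pow 3).const_mul c)).add
        (((hasDerivAt_id (0 : ℝ)).pow 4).const_mul e)
      refine this.congr_deriv ?_
      simp
    refine IsLocalMin.hasDerivAt_eq_zero ?_ hd
    filter_upwards [h] with t ht
    simpa using ht
  refine ⟨ha, ?_⟩
  subst ha
  have hlim : Tendsto (fun t : ℝ => b + c * t + e * t ^ 2) (𝓝[≠] 0) (𝓝 b) := by
    have : ContinuousAt (fun t : ℝ => b + c * t + e * t ^ 2) 0 := by fun_prop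
    simpa [ContinuousAt] using this.tendsto.mono_left nhdsWithin_le_nhds
  refine ge_of_tendsto hlim ?_
  filter_upwards [h.filter_mono nhdsWithin_le_nhds, self_mem_nhdsWithin] with t ht h0
  have h2 : 0 < t ^ 2 := by have : t ≠ 0 := h0
                            positivity
  have : 0 ≤ t ^ 2 * (b + c * t + e * t ^ 2) := by nlinarith
  exact nonneg_of_mul_nonneg_right this h2

/-- The term `D₂` is there because moving two factors linearly moves their product quadratically. -/
lemma second_order {m n : Type*} [Fintype m] [Fintype n] {R D₁ D₂ : Matrix m n ℝ}
    (h : ∀ᶠ t in 𝓝 (0 : ℝ), fro R R ≤ fro (R + t • D₁ + t ^ 2 • D₂) (R + t • D₁ + t ^ 2 • D₂)) :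
    fro R D₁ = 0 ∧ 0 ≤ fro D₁ D₁ + 2 * fro R D₂ := by
  have := coeff_of_eventually_nonneg (a := 2 * fro R D₁) (b := fro D₁ D₁ + 2 * fro R D₂)
    (c := 2 * fro D₁ D₂) (e := fro D₂ D₂) (by
      filter_upwards [h] with t ht
      simp only [fro_add_left, fro_add_right, fro_smul_left, fro_smul_right] at ht
      rw [fro_comm D₁ R, fro_comm D₂ R, fro_comm D₂ D₁] at ht
      linarith)
  exact ⟨by linarith [this.1], this.2⟩

lemma first_order {m n : Type*} [Fintype m] [Fintype n] {R D : Matrix m n ℝ}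
    (h : ∀ᶠ t in 𝓝 (0 : ℝ), fro R R ≤ fro (R + t • D) (R + t • D)) : fro R D = 0 :=
  (second_order (D₂ := 0) (by simpa using h)).1

/-! ### Orthonormal factorization, one-sided inverses, operator norm -/

/-- A matrix factors through an orthonormal basis of its row space. -/
lemma exists_orthonormal_factor {m n : ℕ} (A : Matrix (Fin m) (Fin n) ℝ) :
    ∃ (q : ℕ) (S : Matrix (Fin m) (Fin q) ℝ) (T : Matrix (Fin q) (Fin n) ℝ)
      (C : Matrix (Fin m) (Fin q) ℝ),
      T * Tᵀ = 1 ∧ A = S * T ∧ Cᵀ * S = 1 ∧ Tᵀ = Aᵀ * C := by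
  let K : Submodule ℝ (EuclideanSpace ℝ (Fin n)) := LinearMap.range (toEuclideanLin Aᵀ)
  let b := stdOrthonormalBasis ℝ K
  let T : Matrix (Fin (Module.finrank ℝ K)) (Fin n) ℝ :=
    Matrix.of fun i j => (b i : EuclideanSpace ℝ (Fin n)) j
  have hT : T * Tᵀ = 1 := by
    ext i j
    have h := orthonormal_iff_ite.1 b.orthonormal i j
    rw [Submodule.coe_inner, PiLp.inner_apply] at h
    simp only [RCLike.inner_apply, conj_trivial] at h
    rw [one_apply, ← h, mul_apply]
    exact Finset.sum_congr rfl fun l _ => mul_comm _ _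
  have hC : ∀ i, ∃ c, toEuclideanLin Aᵀ c = (b i : EuclideanSpace ℝ (Fin n)) := fun i => (b i).2
  choose c hc using hC
  let C : Matrix (Fin m) (Fin (Module.finrank ℝ K)) ℝ := Matrix.of fun i j => c j i
  have hTC : Tᵀ = Aᵀ * C := by
    ext i j
    have := congrFun (congrArg WithLp.ofLp (hc j)) i
    simp only [T, transpose_apply, of_apply, ← this]
    rfl
  -- The columns of `C` are preimages of the basis vectors under `Aᵀ`, so `Cᵀ * A = T` and `Cᵀ * (A
  -- * Tᵀ) = T * Tᵀ = 1`.
  refine ⟨_, A * Tᵀ, T, C, hT, ?_, ?_, hTC⟩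
  · ext i j
    have hmem : toEuclideanLin Aᵀ (EuclideanSpace.single i 1) ∈ K := ⟨_, rfl⟩
    have h := congrArg (fun x : K => (x : EuclideanSpace ℝ (Fin n)) j) (b.sum_repr' ⟨_, hmem⟩)
    have hrow : ∀ l, (toEuclideanLin Aᵀ (EuclideanSpace.single i 1)) l = A i l := by
      intro l
      simp [toLpLin_apply]
    simp only [hrow, Submodule.coe_sum, Submodule.coe_smul, Submodule.coe_inner,
      PiLp.inner_apply, WithLp.ofLp_sum, WithLp.ofLp_smul, Finset.sum_apply, Pi.smul_apply,
      RCLike.inner_apply, conj_trivial, smul_eq_mul] at h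
    rw [← h, mul_apply]
    rfl
  · have h := congrArg transpose hTC
    rw [transpose_mul, transpose_transpose, transpose_transpose] at h
    rw [← Matrix.mul_assoc, ← h, hT]

lemma le_of_mul_eq_one {q m : ℕ} {L : Matrix (Fin q) (Fin m) ℝ} {S : Matrix (Fin m) (Fin q) ℝ}
    (h : L * S = 1) : q ≤ m := by
  have h1 := rank_mul_le_left L S
  rw [h, rank_one, Fintype.card_fin] at h1
  exact h1.trans (by simpa using rank_le_card_width L)

/-- Either the Gram matrix `A * Aᵀ` is invertible, or a vector `v` in its kernel satisfies `‖v ᵥ*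
A‖² = 0`. -/
lemma exists_right_inverse_or {m n : ℕ} (A : Matrix (Fin m) (Fin n) ℝ) :
    (∃ B : Matrix (Fin n) (Fin m) ℝ, A * B = 1) ∨ ∃ v ≠ 0, v ᵥ* A = 0 := by
  by_cases h : (A * Aᵀ).det = 0
  · right
    obtain ⟨v, hv, hvA⟩ := exists_vecMul_eq_zero_iff.2 h
    refine ⟨v, hv, ?_⟩
    rw [← vecMul_vecMul, vecMul_transpose] at hvA
    have : (v ᵥ* A) ⬝ᵥ (v ᵥ* A) = 0 := by
      rw [← dotProduct_mulVec, hvA, dotProduct_zero]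
    exact dotProduct_self_eq_zero.1 this
  · left
    exact ⟨Aᵀ * (A * Aᵀ)⁻¹, by
      rw [← Matrix.mul_assoc, mul_nonsing_inv _ (isUnit_iff_ne_zero.2 h)]⟩

lemma exists_left_inverse_or {m n : ℕ} (A : Matrix (Fin m) (Fin n) ℝ) :
    (∃ B : Matrix (Fin n) (Fin m) ℝ, B * A = 1) ∨ ∃ v ≠ 0, A *ᵥ v = 0 := by
  rcases exists_right_inverse_or Aᵀ with ⟨B, hB⟩ | ⟨v, hv, h⟩
  · left
    refine ⟨Bᵀ, ?_⟩
    rw [← transpose_transpose A, ← transpose_mul, hB, transpose_one]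
  · exact .inr ⟨v, hv, by rwa [vecMul_transpose] at h⟩

/-- The number `s` is the squared operator norm of `G`. -/
lemma dotProduct_mulVec_self_le {m n : ℕ} (G : Matrix (Fin m) (Fin n) ℝ) :
    ∃ s : ℝ, 0 ≤ s ∧ (∀ y, (G *ᵥ y) ⬝ᵥ (G *ᵥ y) ≤ s * (y ⬝ᵥ y)) ∧
      ∀ a, 0 ≤ a → (∀ y, (G *ᵥ y) ⬝ᵥ (G *ᵥ y) ≤ a * (y ⬝ᵥ y)) → s ≤ a := by
  have hn : ∀ {p : ℕ} (x : EuclideanSpace ℝ (Fin p)), ‖x‖ ^ 2 = x.ofLp ⬝ᵥ x.ofLp := by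
    intro p x
    rw [EuclideanSpace.norm_sq_eq]
    simp [dotProduct, pow_two]
  let g := LinearMap.toContinuousLinearMap (toEuclideanLin G)
  have hg : ∀ y, (g y).ofLp = G *ᵥ y.ofLp := fun y => rfl
  refine ⟨‖g‖ ^ 2, by positivity, fun y => ?_, fun a ha h => ?_⟩
  · have h1 := pow_le_pow_left₀ (norm_nonneg _) (g.le_opNorm (WithLp.toLp 2 y)) 2
    rw [mul_pow, hn, hn, hg] at h1
    exact h1
  · have : ‖g‖ ≤ √a := by
      refine g.opNorm_le_bound (Real.sqrt_nonneg _) fun y => ?_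
      refine (pow_le_pow_iff_left₀ (norm_nonneg _) (by positivity) two_ne_zero).1 ?_
      rw [mul_pow, hn, hn, Real.sq_sqrt ha, hg]
      exact h _
    calc ‖g‖ ^ 2 ≤ √a ^ 2 := pow_le_pow_left₀ (norm_nonneg _) this 2
      _ = a := Real.sq_sqrt ha

/-! ### Two factors: second order critical points are best approximations -/

section

variable {m n r : ℕ} {B : Matrix (Fin m) (Fin r) ℝ} {A : Matrix (Fin r) (Fin n) ℝ}
  {G : Matrix (Fin m) (Fin n) ℝ}

/-- The test directions are rank one. With `x = Aᵀ *ᵥ c` they turn `B * α` into `(B A x) yᵀ` and `β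
* A` into `-(G y) xᵀ`; these are orthogonal since `Bᵀ * G = 0`, and the term in `β * α` contributes
`-2 ‖x‖² ‖G y‖²`. -/
lemma dotProduct_mul_le_of_second_order (hBG : Bᵀ * G = 0)
    (h : ∀ (α : Matrix (Fin r) (Fin n) ℝ) (β : Matrix (Fin m) (Fin r) ℝ),
      0 ≤ fro (B * α + β * A) (B * α + β * A) + 2 * fro G (β * α))
    (c : Fin r → ℝ) (y : Fin n → ℝ) :
    ((Aᵀ *ᵥ c) ⬝ᵥ (Aᵀ *ᵥ c)) * ((G *ᵥ y) ⬝ᵥ (G *ᵥ y)) ≤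
      ((B * A) *ᵥ (Aᵀ *ᵥ c)) ⬝ᵥ ((B * A) *ᵥ (Aᵀ *ᵥ c)) * (y ⬝ᵥ y) := by
  set x := Aᵀ *ᵥ c with hx
  have h1 := h (vecMulVec (A *ᵥ x) y) (vecMulVec (-(G *ᵥ y)) c)
  have hcA : c ᵥ* A = x := by rw [hx, mulVec_transpose]
  have hort : B *ᵥ (A *ᵥ x) ⬝ᵥ G *ᵥ y = 0 := by
    rw [dotProduct_comm, dotProduct_mulVec, ← mulVec_transpose, mulVec_mulVec, hBG,
      zero_mulVec, zero_dotProduct]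
  have hcx : c ⬝ᵥ A *ᵥ x = x ⬝ᵥ x := by rw [dotProduct_mulVec, hcA]
  rw [mul_vecMulVec, vecMulVec_mul, hcA, vecMulVec_mul_vecMulVec, hcx] at h1
  simp only [fro_add_left, fro_add_right, fro_vecMulVec_vecMulVec] at h1
  simp only [fro_vecMulVec, neg_dotProduct, dotProduct_neg, dotProduct_smul,
    mulVec_smul, smul_eq_mul, dotProduct_comm (G *ᵥ y) (B *ᵥ (A *ᵥ x)), hort] at h1
  rw [← mulVec_mulVec]
  nlinarith

/-- A factored matrix whose factors satisfy the first and second order optimality conditions is a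
best approximation among the matrices with the same inner dimension. -/
theorem best_approx_of_second_order (hBG : Bᵀ * G = 0) (hGA : G * Aᵀ = 0)
    (hA : ∃ R : Matrix (Fin n) (Fin r) ℝ, A * R = 1)
    (h : ∀ (α : Matrix (Fin r) (Fin n) ℝ) (β : Matrix (Fin m) (Fin r) ℝ),
      0 ≤ fro (B * α + β * A) (B * α + β * A) + 2 * fro G (β * α))
    (B' : Matrix (Fin m) (Fin r) ℝ) (A' : Matrix (Fin r) (Fin n) ℝ) :
    fro G G ≤ fro (B' * A' - (B * A - G)) (B' * A' - (B * A - G)) := by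
  obtain ⟨q, S, T, C, hT, hA1, hCS, hTC⟩ := exists_orthonormal_factor A
  obtain ⟨q', S', T', C', hT', hA1', hCS', -⟩ := exists_orthonormal_factor A'
  obtain ⟨s, hs0, hs1, hs2⟩ := dotProduct_mulVec_self_le G
  set W := B * A with hW
  have hWT : W * (Tᵀ * T) = W := by
    rw [hW, hA1]
    simp only [Matrix.mul_assoc]
    rw [← Matrix.mul_assoc T, hT, Matrix.one_mul]
  have hGT : G * Tᵀ = 0 := by rw [hTC, ← Matrix.mul_assoc, hGA, Matrix.zero_mul]
  have hq : r ≤ q := by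
    obtain ⟨R, hR⟩ := hA
    exact le_of_mul_eq_one (L := S) (S := T * R) (by rw [← Matrix.mul_assoc, ← hA1, hR])
  have hq' : q' ≤ r := le_of_mul_eq_one hCS'
  have hTy : ∀ y, (Tᵀ *ᵥ (T *ᵥ y)) ⬝ᵥ (Tᵀ *ᵥ (T *ᵥ y)) = (T *ᵥ y) ⬝ᵥ (T *ᵥ y) := by
    intro y
    rw [dotProduct_mulVec, vecMul_transpose, mulVec_mulVec _ T, hT, one_mulVec]
  have hGs : ∀ y, (G *ᵥ y) ⬝ᵥ (G *ᵥ y) ≤ s * (y ⬝ᵥ y - (T *ᵥ y) ⬝ᵥ (T *ᵥ y)) := by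
    intro y
    have h1 := hs1 (y - Tᵀ *ᵥ (T *ᵥ y))
    have h2 : G *ᵥ (y - Tᵀ *ᵥ (T *ᵥ y)) = G *ᵥ y := by
      rw [mulVec_sub, mulVec_mulVec _ G, hGT, zero_mulVec, sub_zero]
    have h3 : y ⬝ᵥ (Tᵀ *ᵥ (T *ᵥ y)) = (T *ᵥ y) ⬝ᵥ (T *ᵥ y) := by
      rw [dotProduct_mulVec, vecMul_transpose]
    rw [h2, sub_dotProduct, dotProduct_sub, dotProduct_sub, hTy,
      dotProduct_comm (Tᵀ *ᵥ (T *ᵥ y)) y, h3] at h1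
    linarith
  have hWs : ∀ y, s * ((T *ᵥ y) ⬝ᵥ (T *ᵥ y)) ≤ (W *ᵥ y) ⬝ᵥ (W *ᵥ y) := by
    intro y
    -- This choice of `c` makes `Aᵀ *ᵥ c` the projection of `y` onto the row space of `A`.
    have hpair := fun z => dotProduct_mul_le_of_second_order hBG h (C *ᵥ (T *ᵥ y)) z
    have hx : Aᵀ *ᵥ (C *ᵥ (T *ᵥ y)) = Tᵀ *ᵥ (T *ᵥ y) := by rw [mulVec_mulVec, ← hTC]
    have hWx : W *ᵥ (Tᵀ *ᵥ (T *ᵥ y)) = W *ᵥ y := by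
      rw [mulVec_mulVec, mulVec_mulVec, Matrix.mul_assoc, hWT]
    rw [hx, ← hW, hWx, hTy] at hpair
    set a := (T *ᵥ y) ⬝ᵥ (T *ᵥ y)
    have ha : 0 ≤ a := Finset.sum_nonneg fun i _ => mul_self_nonneg _
    have hw : 0 ≤ (W *ᵥ y) ⬝ᵥ (W *ᵥ y) := Finset.sum_nonneg fun i _ => mul_self_nonneg _
    rcases ha.eq_or_lt with h0 | hpos
    · rw [← h0, mul_zero]
      exact hw
    · have := hs2 ((W *ᵥ y) ⬝ᵥ (W *ᵥ y) / a) (by positivity) fun z => by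
        rw [div_mul_eq_mul_div, le_div_iff₀ hpos, mul_comm]
        exact hpair z
      rwa [le_div_iff₀ hpos] at this
  -- Sum `hGs` over the orthonormal basis of the row space of `A'`.
  have key1 : fro (G * T'ᵀ) (G * T'ᵀ) ≤ s * (q' - fro (T * T'ᵀ) (T * T'ᵀ)) := by
    have h1 : (q' : ℝ) =
        fro ((1 : Matrix (Fin n) (Fin n) ℝ) * T'ᵀ) ((1 : Matrix (Fin n) (Fin n) ℝ) * T'ᵀ) := by
      rw [Matrix.one_mul, fro, transpose_transpose, hT', trace_one, Fintype.card_fin]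
    rw [h1, fro_mul_self, fro_mul_self, fro_mul_self, ← Finset.sum_sub_distrib, Finset.mul_sum]
    refine Finset.sum_le_sum fun j _ => ?_
    rw [one_mulVec]
    exact hGs _
  -- Sum `hWs` over the columns of the complementary projection `1 - T'ᵀ * T'`.
  have key2 : s * (q - fro (T * T'ᵀ) (T * T'ᵀ)) ≤ fro W W - fro (W * T'ᵀ) (W * T'ᵀ) := by
    have h1 : (q : ℝ) = fro T T := by
      rw [fro, trace_mul_comm, hT, trace_one, Fintype.card_fin]
    rw [h1, ← fro_sub_mul_proj T hT', ← fro_sub_mul_proj W hT']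
    have h2 : ∀ {p : ℕ} (D : Matrix (Fin p) (Fin n) ℝ), D - D * (T'ᵀ * T') = D * (1 - T'ᵀ * T') :=
      fun D => by rw [Matrix.mul_sub, Matrix.mul_one]
    rw [h2, h2, fro_mul_self, fro_mul_self, Finset.mul_sum]
    exact Finset.sum_le_sum fun j _ => hWs _
  -- With `key1` and `key2` this gives `‖(W - G) * T'ᵀ‖² ≤ ‖W‖²`: no competing row space captures
  -- more of the target than `W` does.
  have hqq : s * q' ≤ s * q := mul_le_mul_of_nonneg_left (by exact_mod_cast hq'.trans hq) hs0
  have hWG : ∀ {p : ℕ} (E : Matrix (Fin n) (Fin p) ℝ),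
      fro ((W - G) * E) ((W - G) * E) = fro (W * E) (W * E) + fro (G * E) (G * E) := by
    intro p E
    have h0 : fro (W * E) (G * E) = 0 := by
      rw [hW, fro, transpose_mul, transpose_mul, ← Matrix.mul_assoc]
      rw [Matrix.mul_assoc Eᵀ, Matrix.mul_assoc Aᵀ, hBG]
      simp
    rw [Matrix.sub_mul, fro_sub_left, fro_sub_right, fro_sub_right, fro_comm (G * E) (W * E), h0]
    ring
  have hZ := hWG (1 : Matrix (Fin n) (Fin n) ℝ)
  simp only [Matrix.mul_one] at hZ
  set D := B' * A' - (W - G) with hD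
  -- Off the row space of `A'` the competitor vanishes, so the error there is that of the target
  -- alone.
  have hDP : D - D * (T'ᵀ * T') = -((W - G) - (W - G) * (T'ᵀ * T')) := by
    have : B' * A' * (T'ᵀ * T') = B' * A' := by
      rw [hA1']
      simp only [Matrix.mul_assoc]
      rw [← Matrix.mul_assoc T', hT', Matrix.one_mul]
    rw [hD, Matrix.sub_mul, this]
    abel
  have h5 := fro_sub_mul_proj D hT'
  rw [hDP, fro_neg_left, fro_neg_right, neg_neg, fro_sub_mul_proj _ hT', hWG, hZ] at h5
  have h6 := fro_self_nonneg (D * T'ᵀ)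
  linarith

end

/-! ### Partial products of layers -/

/-- An infinite sequence of composable layers. -/
abbrev Chain (d : ℕ → ℕ) : Type :=
  ∀ j : ℕ, Matrix (Fin (d (j + 1))) (Fin (d j)) ℝ

/-- The product `M (j - 1) * ⋯ * M i` of the layers between widths `d i` and `d j`. -/
noncomputable def seg {d : ℕ → ℕ} (M : Chain d) (i : ℕ) :
    (j : ℕ) → Matrix (Fin (d j)) (Fin (d i)) ℝ
  -- Comparing values gives the identity for equal indices without a cast; the entries for `i > j`
  -- are junk.
  | 0 => Matrix.of fun a b => if a.val = b.val then 1 else 0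
  | j + 1 =>
      if i = j + 1 then Matrix.of fun a b => if a.val = b.val then 1 else 0 else M j * seg M i j

section seg

variable {d : ℕ → ℕ} (M : Chain d)

lemma seg_self (i : ℕ) : seg M i i = 1 := by
  cases i <;> ext a b <;> simp [seg, one_apply, Fin.ext_iff]

lemma seg_succ {i j : ℕ} (h : i ≤ j) : seg M i (j + 1) = M j * seg M i j := by
  rw [seg, if_neg (by omega)]

lemma seg_trans {i l j : ℕ} (h1 : i ≤ l) (h2 : l ≤ j) : seg M i j = seg M l j * seg M i l := by
  induction j, h2 using Nat.le_induction with
  | base => rw [seg_self, Matrix.one_mul]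
  | succ j hj ih => rw [seg_succ M (h1.trans hj), seg_succ M hj, ih, Matrix.mul_assoc]

lemma seg_succ_self (i : ℕ) : seg M i (i + 1) = M i := by
  rw [seg_succ M le_rfl, seg_self, Matrix.mul_one]

lemma seg_eq_mul_first {i j : ℕ} (h : i < j) : seg M i j = seg M (i + 1) j * M i := by
  rw [seg_trans M (Nat.le_succ i) h, seg_succ_self]

variable {M}

lemma seg_congr {N : Chain d} {i j : ℕ} (hij : i ≤ j) (h : ∀ l, i ≤ l → l < j → M l = N l) :
    seg M i j = seg N i j := by
  induction j, hij using Nat.le_induction with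
  | base => rw [seg_self, seg_self]
  | succ j hj ih =>
    rw [seg_succ M hj, seg_succ N hj, h j hj (Nat.lt_succ_self j),
      ih fun l h1 h2 => h l h1 (h2.trans (Nat.lt_succ_self j))]

end seg

variable {d : ℕ → ℕ}

/-! ### Degenerate case: perturbations that preserve the product -/

lemma tendsto_update_add_smul (M : Chain d) (j : ℕ) (D : Matrix (Fin (d (j + 1))) (Fin (d j)) ℝ) :
    Tendsto (fun t : ℝ => Function.update M j (M j + t • D)) (𝓝 0) (𝓝 M) := by
  have hc : Continuous fun t : ℝ => Function.update M j (M j + t • D) := by fun_prop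
  simpa using hc.tendsto 0

/-- Subtracting the case `t = 0` leaves `v (u ᵥ* G) = 0` for every `u`. -/
lemma eq_zero_of_eventually_mul_vecMulVec {a b c : ℕ} (A : Matrix (Fin a) (Fin b) ℝ)
    {v : Fin b → ℝ} (hv : v ≠ 0) (G : Matrix (Fin a) (Fin c) ℝ)
    (h : ∀ u : Fin a → ℝ, ∀ᶠ t in 𝓝 (0 : ℝ), (A + t • vecMulVec u v)ᵀ * G = 0) : G = 0 := by
  have h1 : ∀ u : Fin a → ℝ, vecMulVec v (u ᵥ* G) = 0 := by
    intro u
    have h0 : Aᵀ * G = 0 := by simpa using (h u).self_of_nhds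
    obtain ⟨t, ht, hne⟩ :=
      (((h u).filter_mono nhdsWithin_le_nhds).and (self_mem_nhdsWithin (s := {(0 : ℝ)}ᶜ))).exists
    rw [transpose_add, Matrix.add_mul, h0, zero_add, transpose_smul, Matrix.smul_mul,
      transpose_vecMulVec, vecMulVec_mul] at ht
    exact (smul_eq_zero.1 ht).resolve_left hne
  obtain ⟨i, hi⟩ := Function.ne_iff.1 hv
  ext x y
  have h2 := congrFun (congrFun (h1 (Pi.single x 1)) i) y
  rw [vecMulVec_apply, single_one_vecMul] at h2
  exact (mul_eq_zero.1 h2).resolve_left hi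

/-- Annihilation by all nearby products of upper layers that agree after multiplication with `N`. -/
lemma eq_zero_of_upper {i : ℕ} {r c : ℕ} (N : Matrix (Fin (d i)) (Fin r) ℝ) (M : Chain d) {j : ℕ}
    (hij : i ≤ j) (hN : ∀ l, i ≤ l → l < j → ∃ v ≠ 0, v ᵥ* (seg M i l * N) = 0)
    (G : Matrix (Fin (d j)) (Fin c) ℝ)
    (h : ∀ᶠ M' in 𝓝 M, (∀ l, l < i ∨ j ≤ l → M' l = M l) → seg M' i j * N = seg M i j * N →
      (seg M' i j)ᵀ * G = 0) : G = 0 := by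
  induction j, hij using Nat.le_induction with
  | base => simpa [seg_self] using h.self_of_nhds
  | succ j hj ih =>
    obtain ⟨v, hv, hvN⟩ := hN j hj (Nat.lt_succ_self j)
    refine eq_zero_of_eventually_mul_vecMulVec (M j) hv G fun u => ?_
    have h1 := (tendsto_update_add_smul M j (vecMulVec u v)).eventually h.eventually_nhds
    filter_upwards [h1] with t ht
    -- The perturbed top layer is peeled off: its transpose times `G` plays the role of `G` for the
    -- remaining layers.
    refine ih (fun l hl hlj => hN l hl (hlj.trans (Nat.lt_succ_self j))) _ ?_
    have hc : Tendsto (fun M' : Chain d => Function.update M' j (M j + t • vecMulVec u v)) (𝓝 M)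
        (𝓝 (Function.update M j (M j + t • vecMulVec u v))) :=
      Continuous.tendsto (by fun_prop) M
    filter_upwards [hc.eventually ht] with M' hM' hag heq
    have hseg : seg (Function.update M' j (M j + t • vecMulVec u v)) i (j + 1) =
        (M j + t • vecMulVec u v) * seg M' i j := by
      rw [seg_succ _ hj, Function.update_self,
        seg_congr hj fun l _ h2 => Function.update_of_ne h2.ne _ _]
    rw [hseg] at hM'
    rw [← Matrix.mul_assoc, ← transpose_mul]
    refine hM' (fun l hl => ?_) ?_
    · rw [Function.update_of_ne (by omega)]
      exact hag l (by omega)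
    · have hz : vecMulVec u v * (seg M i j * N) = 0 := by
        rw [vecMulVec_mul, hvN]
        ext a b
        simp [vecMulVec_apply]
      rw [Matrix.mul_assoc, heq, Matrix.add_mul, Matrix.smul_mul, hz, seg_succ _ hj,
        Matrix.mul_assoc, smul_zero, add_zero]

/-- Annihilation by all nearby products of lower layers that agree after multiplication with `N`. -/
lemma eq_zero_of_lower {j : ℕ} {r c : ℕ} (N : Matrix (Fin r) (Fin (d j)) ℝ) (M : Chain d) {i : ℕ}
    (hij : i ≤ j) (hN : ∀ l, i < l → l ≤ j → ∃ v ≠ 0, (N * seg M l j) *ᵥ v = 0)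
    (G : Matrix (Fin c) (Fin (d i)) ℝ)
    (h : ∀ᶠ M' in 𝓝 M, (∀ l, l < i ∨ j ≤ l → M' l = M l) → N * seg M' i j = N * seg M i j →
      G * (seg M' i j)ᵀ = 0) : G = 0 := by
  induction hij using Nat.decreasingInduction with
  | self => simpa [seg_self] using h.self_of_nhds
  | of_succ i hj ih =>
    obtain ⟨v, hv, hvN⟩ := hN (i + 1) (Nat.lt_succ_self i) hj
    rw [← transpose_eq_zero]
    refine eq_zero_of_eventually_mul_vecMulVec (M i)ᵀ hv Gᵀ fun u => ?_
    have h1 := (tendsto_update_add_smul M i (vecMulVec v u)).eventually h.eventually_nhds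
    filter_upwards [h1] with t ht
    have hT : ((M i)ᵀ + t • vecMulVec u v)ᵀ * Gᵀ = (G * (M i + t • vecMulVec v u)ᵀ)ᵀ := by
      rw [transpose_mul, transpose_transpose, transpose_add, transpose_smul, transpose_vecMulVec,
        transpose_transpose]
    rw [hT, transpose_eq_zero]
    refine ih (fun l hl hlj => hN l ((Nat.lt_succ_self i).trans hl) hlj) _ ?_
    have hc : Tendsto (fun M' : Chain d => Function.update M' i (M i + t • vecMulVec v u)) (𝓝 M)
        (𝓝 (Function.update M i (M i + t • vecMulVec v u))) :=
      Continuous.tendsto (by fun_prop) M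
    filter_upwards [hc.eventually ht] with M' hM' hag heq
    have hseg : seg (Function.update M' i (M i + t • vecMulVec v u)) i j =
        seg M' (i + 1) j * (M i + t • vecMulVec v u) := by
      rw [seg_eq_mul_first _ hj, Function.update_self,
        seg_congr hj fun l h2 _ => Function.update_of_ne (Nat.ne_of_gt h2) _ _]
    rw [hseg] at hM'
    rw [Matrix.mul_assoc, ← transpose_mul]
    refine hM' (fun l hl => ?_) ?_
    · rw [Function.update_of_ne (by omega)]
      exact hag l (by omega)
    · rw [← Matrix.mul_assoc, heq, Matrix.mul_add, Matrix.mul_smul, mul_vecMulVec, hvN,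
        seg_eq_mul_first _ hj, Matrix.mul_assoc, zero_vecMulVec, smul_zero, add_zero]

lemma eq_zero_of_forall_fro {m n : Type*} [Fintype m] [Fintype n] {G : Matrix m n ℝ}
    (h : ∀ D, fro G D = 0) : G = 0 := fro_self_eq_zero (h G)

/-- The first order condition at the layer `m`. -/
lemma layer_gradient_eq_zero {k m : ℕ} (hm : m < k) {Z : Matrix (Fin (d k)) (Fin (d 0)) ℝ}
    {M : Chain d}
    (h : ∀ᶠ M' in 𝓝 M, fro (seg M 0 k - Z) (seg M 0 k - Z) ≤ fro (seg M' 0 k - Z) (seg M' 0 k - Z)) :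
    (seg M (m + 1) k)ᵀ * (seg M 0 k - Z) * (seg M 0 m)ᵀ = 0 := by
  refine eq_zero_of_forall_fro fun D => ?_
  rw [fro_comm, Matrix.mul_assoc, fro_mul_right_left, transpose_transpose, fro_mul_right_right,
    transpose_transpose, fro_comm]
  refine first_order ?_
  filter_upwards [(tendsto_update_add_smul M m D).eventually h] with t ht
  have hseg : seg (Function.update M m (M m + t • D)) 0 k =
      seg M 0 k + t • (seg M (m + 1) k * D * seg M 0 m) := by
    rw [seg_trans _ (Nat.zero_le m) hm.le, seg_eq_mul_first _ hm, Function.update_self,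
      seg_congr hm fun l h2 _ => Function.update_of_ne (Nat.ne_of_gt h2) _ _,
      seg_congr (Nat.zero_le m) fun l _ h2 => Function.update_of_ne (Nat.ne_of_lt h2) _ _,
      seg_trans M (Nat.zero_le m) hm.le, seg_eq_mul_first M hm]
    simp only [Matrix.mul_add, Matrix.add_mul, Matrix.mul_smul, Matrix.smul_mul]
  rw [hseg, add_sub_right_comm] at ht
  exact ht

/-- At a local minimum the residual vanishes if the products above the layer `m` starting at `m`
are not surjective and the products ending at the output from below `m` are not injective. -/
lemma residual_eq_zero {k m : ℕ} (hm : m < k) {Z : Matrix (Fin (d k)) (Fin (d 0)) ℝ}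
    {M : Chain d}
    (h : ∀ᶠ M' in 𝓝 M, fro (seg M 0 k - Z) (seg M 0 k - Z) ≤ fro (seg M' 0 k - Z) (seg M' 0 k - Z))
    (hup : ∀ l, m < l → l < k → ∃ v ≠ 0, v ᵥ* seg M m l = 0)
    (hlow : ∀ l, 0 < l → l ≤ m → ∃ v ≠ 0, seg M l k *ᵥ v = 0) : seg M 0 k - Z = 0 := by
  -- Layer `m` stays fixed. The layers below it move to `M₁`, then those above it to `M₂`, always
  -- with the same full product, so the gradient at `m` vanishes at every such `M₂`.
  refine eq_zero_of_lower (seg M m k) M (Nat.zero_le m)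
    (fun l _ h2 => by rw [← seg_trans M h2 hm.le]; exact hlow l ‹_› h2) _ ?_
  filter_upwards [h.eventually_nhds] with M₁ h₁ hag₁ heq₁
  have hprod₁ : seg M m k * seg M₁ 0 m = seg M 0 k := by
    rw [heq₁, ← seg_trans M (Nat.zero_le m) hm.le]
  have hmM : M₁ m = M m := hag₁ m (.inr le_rfl)
  have hseg₁ : ∀ a l, m ≤ a → a ≤ l → seg M₁ a l = seg M a l := fun a l ha hal =>
    seg_congr hal fun b hb _ => hag₁ b (.inr (ha.trans hb))
  refine eq_zero_of_upper (M m) M₁ (i := m + 1) hm (fun l h1 h2 => ?_) _ ?_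
  · rw [hseg₁ _ _ (Nat.le_succ m) h1, ← seg_eq_mul_first M h1]
    exact hup l h1 h2
  filter_upwards [h₁.eventually_nhds] with M₂ h₂ hag₂ heq₂
  have hlow₂ : seg M₂ 0 m = seg M₁ 0 m :=
    seg_congr (Nat.zero_le m) fun l _ hl => hag₂ l (.inl (by omega))
  have hW : seg M₂ 0 k = seg M 0 k := by
    have hmM₂ : M₂ m = M m := (hag₂ m (.inl (Nat.lt_succ_self m))).trans hmM
    rw [seg_trans _ (Nat.zero_le m) hm.le, seg_eq_mul_first _ hm, hmM₂, heq₂, hlow₂,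
      hseg₁ _ _ (Nat.le_succ m) hm, ← seg_eq_mul_first M hm, hprod₁]
  have := layer_gradient_eq_zero hm (M := M₂) (Z := Z) (by rw [hW]; exact h₂)
  rwa [hW, hlow₂, Matrix.mul_assoc] at this

/-- Some width that every layer product passes through without loss of rank, or a layer at which
all partial products degenerate. -/
lemma exists_full_rank_or_degenerate (M : Chain d) (k : ℕ) :
    (∃ p ≤ k, (∃ R : Matrix (Fin (d 0)) (Fin (d p)) ℝ, seg M 0 p * R = 1) ∧
        ∃ L : Matrix (Fin (d p)) (Fin (d k)) ℝ, L * seg M p k = 1) ∨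
      ∃ m < k, (∀ l, m < l → l < k → ∃ v ≠ 0, v ᵥ* seg M m l = 0) ∧
        ∀ l, 0 < l → l ≤ m → ∃ v ≠ 0, seg M l k *ᵥ v = 0 := by
  classical
  by_cases hA : ∃ p ≤ k, (∃ R : Matrix (Fin (d 0)) (Fin (d p)) ℝ, seg M 0 p * R = 1) ∧
        ∃ L : Matrix (Fin (d p)) (Fin (d k)) ℝ, L * seg M p k = 1
  · exact .inl hA
  right
  push Not at hA
  let P : ℕ → Prop := fun p => ∃ R : Matrix (Fin (d 0)) (Fin (d p)) ℝ, seg M 0 p * R = 1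
  have hP0 : P 0 := ⟨1, by rw [seg_self, Matrix.one_mul]⟩
  -- The layer sought is the last index at which the lower product is surjective.
  obtain ⟨R, hR⟩ : P (Nat.findGreatest P k) := Nat.findGreatest_spec (Nat.zero_le k) hP0
  have hgt : ∀ l, Nat.findGreatest P k < l → l ≤ k → ¬ P l := fun l => Nat.findGreatest_is_greatest
  have hmk : Nat.findGreatest P k ≤ k := Nat.findGreatest_le k
  generalize Nat.findGreatest P k = m at R hR hgt hmk
  have hne : m ≠ k := by
    rintro rfl
    exact hA m le_rfl ⟨R, hR⟩ 1 (by rw [seg_self, Matrix.one_mul])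
  refine ⟨m, lt_of_le_of_ne hmk hne, fun l h1 h2 => ?_, fun l h1 h2 => ?_⟩
  · rcases exists_right_inverse_or (seg M 0 l) with h | ⟨v, hv, h⟩
    · exact absurd h (hgt l h1 h2.le)
    · refine ⟨v, hv, ?_⟩
      rw [seg_trans M (Nat.zero_le m) h1.le, ← vecMul_vecMul] at h
      rw [← vecMul_one (v ᵥ* seg M m l), ← hR, ← vecMul_vecMul, h, zero_vecMul]
  · rcases exists_left_inverse_or (seg M l k) with ⟨L, hL⟩ | h
    · exfalso
      -- `seg M l m` has inverses on both sides, which therefore agree. Hence `seg M 0 l` is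
      -- surjective too, and `l` would be a full rank width.
      have h3 : L * seg M m k * seg M l m = 1 := by
        rw [Matrix.mul_assoc, ← seg_trans M h2 hmk, hL]
      have h4 : seg M l m * (seg M 0 l * R) = 1 := by
        rw [← Matrix.mul_assoc, ← seg_trans M (Nat.zero_le l) h2, hR]
      have h5 : L * seg M m k = seg M 0 l * R := by
        rw [← Matrix.one_mul (seg M 0 l * R), ← h3, Matrix.mul_assoc, h4, Matrix.mul_one]
      refine hA l (h2.trans hmk) ⟨R * seg M l m, ?_⟩ L hL
      rw [← Matrix.mul_assoc, ← h5, h3]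
    · exact h

/-! ### Full rank case and the minimum over chains -/

section vary

variable {k : ℕ} (M : Chain d)

/-- Changing the last layer changes an injective upper product arbitrarily. -/
lemma exists_vary_last {p : ℕ} (hp : p ≤ k) 
    (hL : ∃ L : Matrix (Fin (d p)) (Fin (d (k + 1))) ℝ, L * seg M p (k + 1) = 1)
    (β : Matrix (Fin (d (k + 1))) (Fin (d p)) ℝ) :
    ∃ D : Matrix (Fin (d (k + 1))) (Fin (d k)) ℝ, D * seg M p k = β := by
  obtain ⟨L, hL⟩ := hL
  refine ⟨β * (L * M k), ?_⟩
  rw [Matrix.mul_assoc, Matrix.mul_assoc, ← seg_succ M hp, hL, Matrix.mul_one]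

/-- Changing the first layer changes a surjective lower product arbitrarily. -/
lemma exists_vary_first {p : ℕ} (hp : 0 < p) 
    (hR : ∃ R : Matrix (Fin (d 0)) (Fin (d p)) ℝ, seg M 0 p * R = 1)
    (α : Matrix (Fin (d p)) (Fin (d 0)) ℝ) :
    ∃ D : Matrix (Fin (d (0 + 1))) (Fin (d 0)) ℝ, seg M 1 p * D = α := by
  obtain ⟨R, hR⟩ := hR
  refine ⟨M 0 * R * α, ?_⟩
  rw [← Matrix.mul_assoc, ← Matrix.mul_assoc, ← seg_eq_mul_first M hp, hR, Matrix.one_mul]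

end vary

lemma seg_update_last (M : Chain d) {p k : ℕ} (hp : p ≤ k)
    (D : Matrix (Fin (d (k + 1))) (Fin (d k)) ℝ) :
    seg (Function.update M k D) p (k + 1) = D * seg M p k := by
  rw [seg_succ _ hp, Function.update_self,
    seg_congr hp fun l _ h2 => Function.update_of_ne (Nat.ne_of_lt h2) _ _]

lemma seg_update_first (M : Chain d) {p : ℕ} (hp : 0 < p)
    (D : Matrix (Fin (d (0 + 1))) (Fin (d 0)) ℝ) :
    seg (Function.update M 0 D) 0 p = seg M 1 p * D := by
  rw [seg_eq_mul_first _ hp, Function.update_self,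
    seg_congr hp fun l h1 _ => Function.update_of_ne (Nat.ne_of_gt h1) _ _]

/-- A local minimum of the distance from the product of a chain to `Z` is a global minimum. -/
theorem chain_local_min_is_global {k : ℕ} {Z : Matrix (Fin (d (k + 1))) (Fin (d 0)) ℝ}
    {M : Chain d}
    (h : ∀ᶠ M' in 𝓝 M, fro (seg M 0 (k + 1) - Z) (seg M 0 (k + 1) - Z) ≤
      fro (seg M' 0 (k + 1) - Z) (seg M' 0 (k + 1) - Z)) (N : Chain d) :
    fro (seg M 0 (k + 1) - Z) (seg M 0 (k + 1) - Z) ≤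
      fro (seg N 0 (k + 1) - Z) (seg N 0 (k + 1) - Z) := by
  suffices hG : seg M 0 (k + 1) - Z = 0 ∨ fro (seg M 0 (k + 1) - Z) (seg M 0 (k + 1) - Z) ≤
      fro (seg N 0 (k + 1) - Z) (seg N 0 (k + 1) - Z) by
    rcases hG with hG | hG
    · rw [hG]
      simpa [fro] using fro_self_nonneg (seg N 0 (k + 1) - Z)
    · exact hG
  rcases exists_full_rank_or_degenerate M (k + 1) with ⟨p, hpk, hR, hL⟩ | ⟨m, hm, hup, hlow⟩
  swap
  · exact .inl (residual_eq_zero hm h hup hlow)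
  rcases Nat.eq_zero_or_pos p with rfl | hp
  · left
    refine eq_zero_of_forall_fro fun β => first_order ?_
    obtain ⟨D, hD⟩ := exists_vary_last M (Nat.zero_le k) hL β
    filter_upwards [(tendsto_update_add_smul M k D).eventually h] with t ht
    rwa [seg_update_last M (Nat.zero_le k), Matrix.add_mul, Matrix.smul_mul, hD,
      ← seg_succ M (Nat.zero_le k), add_sub_right_comm] at ht
  rcases hpk.eq_or_lt with rfl | hpk
  · left
    refine eq_zero_of_forall_fro fun α => first_order ?_
    obtain ⟨D, hD⟩ := exists_vary_first M hp hR α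
    filter_upwards [(tendsto_update_add_smul M 0 D).eventually h] with t ht
    rwa [seg_update_first M hp, Matrix.mul_add, Matrix.mul_smul, hD,
      ← seg_eq_mul_first M hp, add_sub_right_comm] at ht
  have hpk' : p ≤ k := Nat.lt_succ_iff.1 hpk
  right
  -- As `0 < p ≤ k`, layers `0` and `k` are distinct and lie on opposite sides of `p`, so they vary
  -- the two factors independently.
  have hBA : seg M 0 (k + 1) = seg M p (k + 1) * seg M 0 p := seg_trans M (Nat.zero_le p) hpk.le
  have hsec : ∀ (α : Matrix (Fin (d p)) (Fin (d 0)) ℝ) (β : Matrix (Fin (d (k + 1))) (Fin (d p)) ℝ),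
      fro (seg M 0 (k + 1) - Z) (seg M p (k + 1) * α + β * seg M 0 p) = 0 ∧
      0 ≤ fro (seg M p (k + 1) * α + β * seg M 0 p) (seg M p (k + 1) * α + β * seg M 0 p) +
        2 * fro (seg M 0 (k + 1) - Z) (β * α) := by
    intro α β
    obtain ⟨D, hD⟩ := exists_vary_first M hp hR α
    obtain ⟨E, hE⟩ := exists_vary_last M hpk' hL β
    refine second_order ?_
    have hc : Tendsto (fun t : ℝ => Function.update (Function.update M 0 (M 0 + t • D)) k
        (M k + t • E)) (𝓝 0) (𝓝 M) := by
      have hc : Continuous fun t : ℝ => Function.update (Function.update M 0 (M 0 + t • D)) k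
        (M k + t • E) := by fun_prop
      simpa using hc.tendsto 0
    filter_upwards [hc.eventually h] with t ht
    have hup : seg (Function.update (Function.update M 0 (M 0 + t • D)) k (M k + t • E)) p (k + 1) =
        seg M p (k + 1) + t • β := by
      rw [seg_update_last _ hpk', Matrix.add_mul, Matrix.smul_mul,
        seg_congr hpk' fun l h1 _ => Function.update_of_ne (Nat.ne_of_gt (hp.trans_le h1)) _ _,
        hE, ← seg_succ M hpk']
    have hlow : seg (Function.update (Function.update M 0 (M 0 + t • D)) k (M k + t • E)) 0 p =
        seg M 0 p + t • α := by
      rw [seg_congr (Nat.zero_le p) fun l _ h2 =>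
        Function.update_of_ne (Nat.ne_of_lt (h2.trans_le hpk')) _ _,
        seg_update_first M hp, Matrix.mul_add, Matrix.mul_smul, hD, ← seg_eq_mul_first M hp]
    have heq : (seg M p (k + 1) + t • β) * (seg M 0 p + t • α) - Z =
        seg M 0 (k + 1) - Z + t • (seg M p (k + 1) * α + β * seg M 0 p) + t ^ 2 • (β * α) := by
      rw [hBA]
      simp only [Matrix.add_mul, Matrix.mul_add, Matrix.smul_mul, Matrix.mul_smul, smul_add,
        smul_smul, pow_two]
      abel
    rwa [seg_trans (Function.update (Function.update M 0 (M 0 + t • D)) k (M k + t • E))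
      (Nat.zero_le p) hpk.le, hup, hlow, heq] at ht
  have hBG : (seg M p (k + 1))ᵀ * (seg M 0 (k + 1) - Z) = 0 := by
    refine eq_zero_of_forall_fro fun α => ?_
    have := (hsec α 0).1
    rwa [Matrix.zero_mul, add_zero, fro_mul_right_left] at this
  have hGA : (seg M 0 (k + 1) - Z) * (seg M 0 p)ᵀ = 0 := by
    refine eq_zero_of_forall_fro fun β => ?_
    have := (hsec 0 β).1
    rwa [Matrix.mul_zero, zero_add, fro_mul_right_right] at this
  have := best_approx_of_second_order hBG hGA hR (fun α β => (hsec α β).2) (seg N p (k + 1))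
    (seg N 0 p)
  rwa [← hBA, ← seg_trans N (Nat.zero_le p) hpk.le, sub_sub_cancel] at this

/-! ### Reduction from general data to approximation of one matrix -/

/-- The first `k` layers of a chain. -/
def Chain.toParams (M : Chain d) (k : ℕ) : Params d k := fun i => M i

/-- A chain with the given first layers and zeros afterwards. -/
noncomputable def Params.toChain {k : ℕ} (M : Params d k) : Chain d :=
  fun j => if h : j < k then M ⟨j, h⟩ else 0

lemma toParams_toChain {k : ℕ} (M : Params d k) : (Params.toChain M).toParams k = M := by
  funext i
  simp [Chain.toParams, Params.toChain]

lemma layerProd_toParams (M : Chain d) (k : ℕ) : layerProd d k (M.toParams k) = seg M 0 k := by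
  induction k with
  | zero => rw [seg_self]; rfl
  | succ k ih => rw [seg_succ M (Nat.zero_le k), ← ih]; rfl

lemma continuous_toParams (k : ℕ) : Continuous fun M : Chain d => M.toParams k :=
  continuous_pi fun i => continuous_apply (i : ℕ)

/-- The widths with `d 0` replaced by `q`. -/
def replaceInput (d : ℕ → ℕ) (q : ℕ) : ℕ → ℕ
  | 0 => q
  | j + 1 => d (j + 1)

/-- The chain with its first layer replaced. -/
def Chain.withFirst {q : ℕ} (M : Chain d) (A : Matrix (Fin (d 1)) (Fin q) ℝ) :
    Chain (replaceInput d q)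
  | 0 => A
  | j + 1 => M (j + 1)

/-- The chain with the original input width, first layer `A` and the later layers of `M`. -/
def Chain.ofWithFirst {q : ℕ} (M : Chain (replaceInput d q))
    (A : Matrix (Fin (d 1)) (Fin (d 0)) ℝ) :
    Chain d
  | 0 => A
  | j + 1 => M (j + 1)

/-- The first layer of a chain with replaced input width. -/
def Chain.first {q : ℕ} (V : Chain (replaceInput d q)) : Matrix (Fin (d 1)) (Fin q) ℝ := V 0

lemma seg_withFirst {q : ℕ} (M : Chain d) (S : Matrix (Fin (d 0)) (Fin q) ℝ) (k : ℕ) :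
    (seg (M.withFirst (M 0 * S)) 0 (k + 1) : Matrix (Fin (d (k + 1))) (Fin q) ℝ) =
      seg M 0 (k + 1) * S := by
  induction k with
  | zero =>
    have h : seg M 0 (0 + 1) = M 0 := seg_succ_self M 0
    rw [h]
    exact seg_succ_self (M.withFirst (M 0 * S)) 0
  | succ k ih =>
    rw [seg_succ M (Nat.zero_le _), Matrix.mul_assoc, ← ih]
    exact seg_succ _ (Nat.zero_le _)

lemma loss_toParams (M : Chain d) (k n : ℕ) (X : Matrix (Fin (d 0)) (Fin n) ℝ)
    (Y : Matrix (Fin (d k)) (Fin n) ℝ) :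
    loss d k n X Y (M.toParams k) = fro (seg M 0 k * X - Y) (seg M 0 k * X - Y) := by
  rw [loss, layerProd_toParams, frobenius_norm_sq_eq_fro]

lemma fro_mul_sub_eq {m n q : ℕ} (V : Matrix (Fin m) (Fin q) ℝ) {T : Matrix (Fin q) (Fin n) ℝ}
    (hT : T * Tᵀ = 1) (Y : Matrix (Fin m) (Fin n) ℝ) :
    fro (V * T - Y) (V * T - Y) =
      fro (V - Y * Tᵀ) (V - Y * Tᵀ) + fro (Y - Y * (Tᵀ * T)) (Y - Y * (Tᵀ * T)) := by
  have h := fro_sub_mul_proj (V * T - Y) hT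
  have h1 : (V * T - Y) * Tᵀ = V - Y * Tᵀ := by
    rw [Matrix.sub_mul, Matrix.mul_assoc, hT, Matrix.mul_one]
  have h2 : V * T - Y - (V * T - Y) * (Tᵀ * T) = -(Y - Y * (Tᵀ * T)) := by
    rw [← Matrix.mul_assoc (V * T - Y), h1, Matrix.sub_mul, Matrix.mul_assoc Y]
    abel
  rw [h1, h2, fro_neg_left, fro_neg_right, neg_neg] at h
  linarith

theorem loss_local_min_is_global (k n : ℕ) (X : Matrix (Fin (d 0)) (Fin n) ℝ)
    (Y : Matrix (Fin (d (k + 1))) (Fin n) ℝ) (M : Params d (k + 1))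
    (hM : IsLocalMin (loss d (k + 1) n X Y) M) (N : Params d (k + 1)) :
    loss d (k + 1) n X Y M ≤ loss d (k + 1) n X Y N := by
  obtain ⟨q, S, T, C, hT, hX, hCS, -⟩ := exists_orthonormal_factor X
  let red : Chain d → Chain (replaceInput d q) := fun M => M.withFirst (M 0 * S)
  let Z : Matrix (Fin (replaceInput d q (k + 1))) (Fin (replaceInput d q 0)) ℝ :=
    (Y * Tᵀ : Matrix (Fin (d (k + 1))) (Fin q) ℝ)
  have hloss : ∀ M : Chain d, loss d (k + 1) n X Y (M.toParams (k + 1)) =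
      fro (seg (red M) 0 (k + 1) - Z) (seg (red M) 0 (k + 1) - Z) +
        fro (Y - Y * (Tᵀ * T)) (Y - Y * (Tᵀ * T)) := by
    intro M
    have h := seg_withFirst M S k
    rw [loss_toParams, hX, ← Matrix.mul_assoc, fro_mul_sub_eq _ hT, ← h]
    rfl
  set M' := Params.toChain M with hM'
  -- A continuous section of `red` through `M'`, built from the left inverse `Cᵀ` of `S`; it pulls
  -- the local minimum back to the reduced problem.
  let lift : Chain (replaceInput d q) → Chain d := fun V =>
    V.ofWithFirst (M' 0 + (V.first - M' 0 * S) * Cᵀ)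
  have hred : ∀ V, red (lift V) = V := by
    intro V
    funext j
    cases j with
    | zero =>
      change (M' 0 + (V.first - M' 0 * S) * Cᵀ) * S = V.first
      rw [Matrix.add_mul, Matrix.mul_assoc, hCS, Matrix.mul_one, add_sub_cancel]
    | succ j => rfl
  have hlift : lift (red M') = M' := by
    funext j
    cases j with
    | zero =>
      change M' 0 + ((M' 0 * S : Matrix (Fin (d 1)) (Fin q) ℝ) - M' 0 * S) * Cᵀ = M' 0
      rw [sub_self, Matrix.zero_mul, add_zero]
    | succ j => rfl
  have hcont : Continuous lift := by
    refine continuous_pi fun j => ?_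
    cases j with
    | zero =>
      have h0 : Continuous fun V : Chain (replaceInput d q) => V.first :=
        continuous_apply (A := fun j => Matrix (Fin (replaceInput d q (j + 1)))
          (Fin (replaceInput d q j)) ℝ) 0
      change Continuous fun V : Chain (replaceInput d q) => M' 0 + (V.first - M' 0 * S) * Cᵀ
      fun_prop
    | succ j => exact continuous_apply (A := fun j => Matrix (Fin (replaceInput d q (j + 1)))
        (Fin (replaceInput d q j)) ℝ) (j + 1)
  have hlim : Tendsto (fun V => (lift V).toParams (k + 1)) (𝓝 (red M')) (𝓝 M) := by
    have := ((continuous_toParams (k + 1)).comp hcont).tendsto (red M')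
    rwa [Function.comp_apply, hlift, hM', toParams_toChain] at this
  have hMc : loss d (k + 1) n X Y M = loss d (k + 1) n X Y (M'.toParams (k + 1)) := by
    rw [hM', toParams_toChain]
  have hloc := hlim.eventually hM
  have key := chain_local_min_is_global (d := replaceInput d q) (Z := Z) (M := red M') (k := k) (by
    filter_upwards [hloc] with V hV
    rw [hMc, hloss, hloss, hred] at hV
    exact le_of_add_le_add_right hV) (red (Params.toChain N))
  rw [hMc, ← toParams_toChain N, hloss, hloss]
  exact add_le_add_left key _

end DeepLinear

theorem mainTheorem2 (k : ℕ) (hk : 1 ≤ k) (d : ℕ → ℕ) (n : ℕ)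
    (X : Matrix (Fin (d 0)) (Fin n) ℝ) (Y : Matrix (Fin (d k)) (Fin n) ℝ) :
    ¬ ∃ M : DeepLinear.Params d k,
      DeepLinear.IsSpuriousLocalMin (DeepLinear.loss d k n X Y) M := by
  rintro ⟨M, hM, hglob⟩
  cases k with
  | zero => exact absurd hk (by norm_num)
  | succ k => exact hglob (DeepLinear.loss_local_min_is_global k n X Y M hM)
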